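/- Let $k$ be a field of characteristic zero and let $B$ be a $k$-domain, i.e. a commutative integral domain that is also a $k$-algebra. Let $\mathrm{LND}(B)$ be the set of locally nilpotent derivations of $B$, i.e. derivations $D : B \to B$ such that for every $x \in B$ there is $n \in \mathbb{N}$ with $D^n(x) = 0$. For $\Delta \subseteq \mathrm{LND}(B)$ put $A_\Delta = \bigcap_{D \in \Delta} \ker D$ (so $A_\emptyset = B$), and let $\mathscr{A}_1(B)$ be the set of all subrings $A$ of $B$ of the form $A = A_\Delta$ such that $B$ has transcendence degree $1$ over $A$. One says that $B$ is semi-rigid if $\mathscr{A}_1(B)$ has at most one element. For a field $F$ and $n \in \mathbb{N}$, write $L = F^{(n)}$ if $L$ is a field of rational functions in $n$ variables over $F$, i.e. $L$ is generated as a field over $F$ by $n$ elements that are algebraically independent over $F$. A field extension $L/E$ is called ruled if there is a field $F$ with $E \subseteq F \subseteq L$ and $L = F^{(1)}$. Assume that $B$ has finite transcendence degree over $k$ and that $B$ is not semi-rigid. Then the following hold. (a) For every $D \in \mathrm{LND}(B)$, the field $\mathrm{Frac}(\ker D)$ contains $k$ and is ruled over $k$. (b) There exists a field $K$ such that $k \subseteq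 K \subseteq \mathrm{Frac}\, B$ and $\mathrm{Frac}\, B = K^{(2)}$. -/

import Mathlib

namespace LNDRuled

section Derivations

variable (B : Type*) [CommRing B]

/-- The set of locally nilpotent derivations `D : B → B`; derivations of the ring `B` are only
required to be additive (that is, `ℤ`-linear) and to satisfy the Leibniz rule. -/
def LND : Set (Derivation ℤ B B) :=
  {D | ∀ b : B, ∃ n : ℕ, D^[n] b = 0}

variable {B}

/-- The kernel of a derivation of `B`, a subring of `B`. -/
def ker (D : Derivation ℤ B B) : Subring B where
  carrier := {b | D b = 0}
  zero_mem' := map_zero D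
  one_mem' := D.map_one_eq_zero
  add_mem' := by
    intro a b (ha : D a = 0) (hb : D b = 0)
    show D (a + b) = 0
    rw [map_add, ha, hb, add_zero]
  neg_mem' := by
    intro a (ha : D a = 0)
    show D (-a) = 0
    rw [map_neg, ha, neg_zero]
  mul_mem' := by
    intro a b (ha : D a = 0) (hb : D b = 0)
    show D (a * b) = 0
    rw [D.leibniz, ha, hb, smul_zero, smul_zero, add_zero]

/-- The intersection in `B` of the kernels of the derivations in `Δ`; it is `B` when `Δ = ∅`. -/
def kerInter (Δ : Set (Derivation ℤ B B)) : Subring B :=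
  ⨅ D ∈ Δ, ker D

variable (B)

/-- The set of all intersections of kernels of locally nilpotent derivations of `B`. -/
def kernelLattice : Set (Subring B) :=
  {A | ∃ Δ ⊆ LND B, A = kerInter Δ}

/-- The members `A` of `kernelLattice B` such that `B` has transcendence degree `n` over `A`. -/
def kernelsOfCodim (n : ℕ) : Set (Subring B) :=
  {A | A ∈ kernelLattice B ∧ Algebra.trdeg A B = n}

/-- `B` is semi-rigid if at most one member of `kernelLattice B` has codimension one. -/
def IsSemiRigid : Prop :=
  (kernelsOfCodim B 1).encard ≤ 1

end Derivations

section Fields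

variable {Ω : Type*} [Field Ω]

/-- `L = F^(n)`: the field `L` is generated over its subfield `F` by `n` elements that are
algebraically independent over `F`, i.e. `L` is a field of rational functions in `n` variables
over `F`. -/
def IsRationalFunctionField (F L : Subfield Ω) (n : ℕ) : Prop :=
  ∃ x : Fin n → Ω, AlgebraicIndependent F x ∧
    Subfield.closure ((F : Set Ω) ∪ Set.range x) = L

/-- `L` is ruled over `E`: there is a field `F` with `E ⊆ F ⊆ L` and `L = F^(1)`. -/
def IsRuled (E L : Subfield Ω) : Prop :=
  ∃ F : Subfield Ω, E ≤ F ∧ F ≤ L ∧ IsRationalFunctionField F L 1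

end Fields

section Fractions

/-- The field of fractions of a subring `A` of the domain `B`, as a subfield of `Frac B`. -/
noncomputable def fracSubring {B : Type*} [CommRing B] [IsDomain B] (A : Subring B) :
    Subfield (FractionRing B) :=
  Subfield.closure (algebraMap B (FractionRing B) '' (A : Set B))

/-- The base field `k` of a `k`-domain `B`, as a subfield of `Frac B`. -/
noncomputable def baseField (k B : Type*) [Field k] [CommRing B] [IsDomain B] [Algebra k B] :
    Subfield (FractionRing B) :=
  ((algebraMap B (FractionRing B)).comp (algebraMap k B)).fieldRange

end Fractions

end LNDRuled

/-! Let `L` be the fraction field of `ker D` for a nonzero locally nilpotent `D`. A local slice `s`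
(`D s ≠ 0`, `D (D s) = 0`) gives `Frac B = L(s)` with `s` transcendental over `L`. Failure of
semi-rigidity supplies a second nonzero `D'` with a different kernel, so also `Frac B = L'(s')`.
Kernels of this kind are incomparable, hence some `c ∈ ker D'` lies outside `ker D`; it is a
polynomial of positive degree in `s` over `L`.

Expanding in powers of `s⁻¹` embeds `Frac B` in the Laurent series over `L`. The order is a
valuation on `L'(s')` with residue field `L`, and it is nontrivial on `L'` because `c` has a pole.
By Abhyankar's inequality the residues of `L'` have smaller transcendence degree over `k` than `L'`,
that is, than `L`, so `L` is not algebraic over them. The ruled residue theorem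
(`exists_closure_insert_eq_top`) then gives `L = F(t)`, where `F` is the algebraic closure in `L` of
the field of residues of `L'`. This is (a) for `D ≠ 0`, and `Frac B = F(t)(s)` is (b). For `D = 0`
the kernel is `B`, and `Frac B = L(s)` is already ruled. -/

namespace LNDRuled

/-! ### Residues and leading coefficients of Laurent series -/

section LeadingCoefficients

open scoped LaurentSeries

variable {κ : Type*} [Field κ]

/-- The leading coefficient of a Laurent series, as a multiplicative map. -/
noncomputable def leadingCoeffHom (κ : Type*) [Field κ] : κ⸨X⸩ →*₀ κ where
  toFun := HahnSeries.leadingCoeff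
  map_zero' := HahnSeries.leadingCoeff_zero
  map_one' := HahnSeries.leadingCoeff_one
  map_mul' x y := HahnSeries.leadingCoeff_mul x y

theorem leadingCoeffHom_eq_zero {z : κ⸨X⸩} : leadingCoeffHom κ z = 0 ↔ z = 0 :=
  HahnSeries.leadingCoeff_eq_zero

theorem leadingCoeffHom_eq_coeff (z : κ⸨X⸩) : leadingCoeffHom κ z = z.coeff z.order :=
  HahnSeries.leadingCoeff_eq

theorem order_inv (z : κ⸨X⸩) : (z⁻¹).order = -z.order := by
  rcases eq_or_ne z 0 with rfl | hz
  · simp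
  have h := HahnSeries.order_mul hz (inv_ne_zero hz)
  rw [mul_inv_cancel₀ hz, HahnSeries.order_one] at h
  omega

theorem order_zpow (z : κ⸨X⸩) (n : ℤ) : (z ^ n).order = n * z.order := by
  cases n with
  | ofNat n => simp
  | negSucc n => rw [zpow_negSucc, order_inv, HahnSeries.order_pow, Int.negSucc_eq]; simp; ring

/-- For a Laurent series `c` of nonzero order, the series `z ^ ord c / c ^ ord z` has order zero;
`ResiduallyIn F c z` says that its residue lies in `F`. -/
def ResiduallyIn (F : Subfield κ) (c z : κ⸨X⸩) : Prop :=
  leadingCoeffHom κ z ^ c.order / leadingCoeffHom κ c ^ z.order ∈ F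

variable {F : Subfield κ} {c : κ⸨X⸩}

theorem residuallyIn_zero (hc : c.order ≠ 0) : ResiduallyIn F c 0 := by
  simp [ResiduallyIn, zero_zpow _ hc]

theorem ne_zero_of_order_ne_zero (hc : c.order ≠ 0) : c ≠ 0 := by
  rintro rfl; simp at hc

theorem ResiduallyIn.mul (hc : c.order ≠ 0) {y z : κ⸨X⸩} (hy : ResiduallyIn F c y)
    (hz : ResiduallyIn F c z) : ResiduallyIn F c (y * z) := by
  rcases eq_or_ne y 0 with rfl | hy0
  · simpa using residuallyIn_zero hc
  rcases eq_or_ne z 0 with rfl | hz0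
  · simpa using residuallyIn_zero hc
  have hc0 : leadingCoeffHom κ c ≠ 0 :=
    leadingCoeffHom_eq_zero.not.2 (ne_zero_of_order_ne_zero hc)
  have := F.mul_mem hy hz
  rwa [div_mul_div_comm, ← mul_zpow, ← map_mul, ← zpow_add₀ hc0, ← HahnSeries.order_mul hy0 hz0]
    at this

theorem ResiduallyIn.inv {z : κ⸨X⸩} (hz : ResiduallyIn F c z) : ResiduallyIn F c z⁻¹ := by
  have := F.inv_mem hz
  unfold ResiduallyIn
  rw [order_inv, map_inv₀, inv_zpow, zpow_neg, div_inv_eq_mul, mul_comm, ← div_eq_mul_inv]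
  rwa [inv_div] at this

theorem ResiduallyIn.zpow {z : κ⸨X⸩} (hz : ResiduallyIn F c z) (n : ℤ) :
    ResiduallyIn F c (z ^ n) := by
  have := F.zpow_mem hz n
  unfold ResiduallyIn
  rwa [order_zpow, map_zpow₀, mul_comm n, zpow_mul, ← zpow_mul, mul_comm n, zpow_mul, ← div_zpow]

theorem mem_of_zpow_mem (hF : ∀ y : κ, IsAlgebraic F y → y ∈ F) {y : κ} {n : ℤ} (hn : n ≠ 0)
    (h : y ^ n ∈ F) : y ∈ F := by
  have key : ∀ m : ℕ, 0 < m → y ^ m ∈ F → y ∈ F := fun m hm h ↦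
    hF y (IsAlgebraic.of_pow hm (isAlgebraic_algebraMap (⟨_, h⟩ : F)))
  refine key n.natAbs (Int.natAbs_pos.2 hn) ?_
  rcases Int.natAbs_eq n with h' | h'
  · rwa [h', zpow_natCast] at h
  · rw [h', zpow_neg, zpow_natCast] at h
    simpa using F.inv_mem h

/-- Passing from `z` to `z ^ n` raises the residue to the power `n`, and `F` contains the roots in
`κ` of its elements. This is why `F` must be algebraically closed in `κ`. -/
theorem ResiduallyIn.of_zpow (hF : ∀ y : κ, IsAlgebraic F y → y ∈ F) {z : κ⸨X⸩} {n : ℤ}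
    (hn : n ≠ 0) (h : ResiduallyIn F c (z ^ n)) : ResiduallyIn F c z := by
  refine mem_of_zpow_mem hF hn ?_
  unfold ResiduallyIn at h
  rwa [order_zpow, map_zpow₀, mul_comm n, zpow_mul, ← zpow_mul, mul_comm n, zpow_mul, ← div_zpow]
    at h

theorem ResiduallyIn.leadingCoeff_mem (hF : ∀ y : κ, IsAlgebraic F y → y ∈ F)
    (hc : c.order ≠ 0) {z : κ⸨X⸩} (hz : ResiduallyIn F c z) (h0 : z.order = 0) :
    leadingCoeffHom κ z ∈ F := by
  refine mem_of_zpow_mem hF hc ?_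
  simpa [ResiduallyIn, h0] using hz

theorem residuallyIn_of_order_eq_zero {z : κ⸨X⸩} (h0 : z.order = 0)
    (h : leadingCoeffHom κ z ∈ F) : ResiduallyIn F c z := by
  simpa [ResiduallyIn, h0] using F.zpow_mem h _

theorem residuallyIn_self : ResiduallyIn F c c := by
  rcases eq_or_ne c 0 with rfl | hc
  · simp [ResiduallyIn, F.one_mem]
  · have : leadingCoeffHom κ c ≠ 0 := leadingCoeffHom_eq_zero.not.2 hc
    unfold ResiduallyIn
    rw [div_self (zpow_ne_zero _ this)]
    exact F.one_mem

theorem transcendental_of_notMem (hF : ∀ y : κ, IsAlgebraic F y → y ∈ F) {t : κ} (ht : t ∉ F) :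
    Transcendental F t := fun h ↦ ht (hF t h)

/-- If `f` is not residually in `F`, the residues of the products of powers of `f` with elements
residually in `F` are governed by a single element `t ∉ F`. -/
theorem exists_residue_generator (hF : ∀ y : κ, IsAlgebraic F y → y ∈ F) (hc : c.order ≠ 0)
    {f : κ⸨X⸩} (hf : ¬ ResiduallyIn F c f) :
    ∃ e : ℕ, 0 < e ∧ ∃ t : κ, t ∉ F ∧ ∀ (i : ℤ) (g : κ⸨X⸩), g ≠ 0 → ResiduallyIn F c g →
      (g * f ^ i).order = 0 →
      ∃ j : ℤ, i = e * j ∧ leadingCoeffHom κ (g * f ^ i) / t ^ j ∈ F := by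
  classical
  have hf0 : f ≠ 0 := by rintro rfl; exact hf (residuallyIn_zero hc)
  have hc0 := ne_zero_of_order_ne_zero hc
  -- The least such `e` is the order of `f` modulo the orders of series residually in `F`; it is
  -- finite since `c ^ (± f.order)` realizes `|c.order| * f.order`. The generator `t` will be the
  -- residue of `f ^ e / h`.
  have hex : ∃ e : ℕ, 0 < e ∧ ∃ h : κ⸨X⸩, h ≠ 0 ∧ ResiduallyIn F c h ∧
      h.order = e * f.order := by
    rcases Int.natAbs_eq c.order with h | h
    · refine ⟨c.order.natAbs, Int.natAbs_pos.2 hc, c ^ f.order, zpow_ne_zero _ hc0,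
        residuallyIn_self.zpow _, ?_⟩
      rw [order_zpow, ← h, mul_comm]
    · refine ⟨c.order.natAbs, Int.natAbs_pos.2 hc, c ^ (-f.order), zpow_ne_zero _ hc0,
        residuallyIn_self.zpow _, ?_⟩
      rw [order_zpow, neg_mul, mul_comm, ← neg_mul]
      congr 1; omega
  obtain ⟨he, h, hh0, hhT, hho⟩ := Nat.find_spec hex
  have hmin : ∀ m < Nat.find hex, _ := fun m hm ↦ Nat.find_min hex hm
  generalize Nat.find hex = e at *
  have hu : (f ^ (e : ℤ) * h⁻¹).order = 0 := by
    rw [HahnSeries.order_mul (zpow_ne_zero _ hf0) (inv_ne_zero hh0), order_inv, order_zpow, hho]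
    ring
  refine ⟨e, he, leadingCoeffHom κ (f ^ (e : ℤ) * h⁻¹), fun ht ↦ hf ?_, fun i g hg0 hg ho ↦ ?_⟩
  · refine ResiduallyIn.of_zpow hF (n := e) (by omega) ?_
    have := (residuallyIn_of_order_eq_zero (c := c) hu ht).mul hc hhT
    rwa [mul_assoc, inv_mul_cancel₀ hh0, mul_one] at this
  have hfi : ∀ i : ℤ, f ^ i ≠ 0 := fun i ↦ zpow_ne_zero _ hf0
  have hhi : ∀ i : ℤ, h ^ i ≠ 0 := fun i ↦ zpow_ne_zero _ hh0
  rw [HahnSeries.order_mul hg0 (hfi i), order_zpow] at ho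
  -- Otherwise the remainder `i % e` is a smaller positive exponent with the property defining `e`.
  have hdiv : i = e * (i / e) := by
    by_contra hne
    have hmod := Int.emod_add_mul_ediv i e
    have hpos : 0 ≤ i % e := Int.emod_nonneg _ (by omega)
    have hlt : i % e < e := Int.emod_lt_of_pos _ (by omega)
    refine hmin (i % e).toNat (by omega) ⟨by omega, (g * h ^ (i / e))⁻¹,
      inv_ne_zero (mul_ne_zero hg0 (hhi _)), (hg.mul hc (hhT.zpow _)).inv, ?_⟩
    rw [order_inv, HahnSeries.order_mul hg0 (hhi _), order_zpow, hho, Int.toNat_of_nonneg hpos]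
    linear_combination -ho - f.order * hmod
  refine ⟨i / e, hdiv, ?_⟩
  generalize i / e = j at *
  subst hdiv
  have : leadingCoeffHom κ (g * f ^ ((e : ℤ) * j)) / leadingCoeffHom κ (f ^ (e : ℤ) * h⁻¹) ^ j =
      leadingCoeffHom κ (g * h ^ j) := by
    rw [← map_zpow₀, ← map_div₀, mul_zpow, ← zpow_mul, inv_zpow]
    congr 1
    have := hfi (e * j)
    have := hhi j
    field_simp
  rw [this]
  refine (hg.mul hc (hhT.zpow j)).leadingCoeff_mem hF hc ?_
  rw [HahnSeries.order_mul hg0 (hhi _), order_zpow, hho]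
  linear_combination ho

/-- The leading coefficient of a polynomial in `f` whose coefficients are residually in `F`. -/
theorem exists_leadingTerm_of_sum (hF : ∀ y : κ, IsAlgebraic F y → y ∈ F)
    {f : κ⸨X⸩} (hf0 : f ≠ 0) (hc : c.order ≠ 0) {e : ℕ} (he : 0 < e) {t : κ} (ht : t ∉ F)
    (h : ∀ (i : ℤ) (g : κ⸨X⸩), g ≠ 0 → ResiduallyIn F c g → (g * f ^ i).order = 0 →
      ∃ j : ℤ, i = e * j ∧ leadingCoeffHom κ (g * f ^ i) / t ^ j ∈ F)
    (n : ℕ) (g : ℕ → κ⸨X⸩) (hg : ∀ i, ResiduallyIn F c (g i))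
    (hz : ∑ i ∈ Finset.range n, g i * f ^ i ≠ 0) :
    ∃ i : ℕ, g i ≠ 0 ∧ (∑ i ∈ Finset.range n, g i * f ^ i).order = (g i * f ^ i).order ∧
      leadingCoeffHom κ (∑ i ∈ Finset.range n, g i * f ^ i) / leadingCoeffHom κ (g i * f ^ i) ∈
        Subfield.closure ((F : Set κ) ∪ {t}) := by
  classical
  have ht0 : t ≠ 0 := by rintro rfl; exact ht F.zero_mem
  set z := ∑ i ∈ Finset.range n, g i * f ^ i with hzdef
  have hJ : ((Finset.range n).filter fun i ↦ g i ≠ 0).Nonempty := by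
    by_contra hJ
    rw [Finset.not_nonempty_iff_eq_empty, Finset.filter_eq_empty_iff] at hJ
    refine hz (Finset.sum_eq_zero fun i hi ↦ ?_)
    rw [not_not.1 (hJ hi), zero_mul]
  obtain ⟨i₁, hi₁, hmin₁⟩ := Finset.exists_min_image _ (fun i ↦ (g i * f ^ i).order) hJ
  set m := (g i₁ * f ^ i₁).order
  set I := (Finset.range n).filter fun i ↦ g i ≠ 0 ∧ (g i * f ^ i).order = m with hI
  have hIne : I.Nonempty := 
    ⟨i₁, Finset.mem_filter.2 ⟨(Finset.mem_filter.1 hi₁).1, (Finset.mem_filter.1 hi₁).2, rfl⟩⟩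
  -- Only the terms of minimal order `m` contribute to `z.coeff m`. Dividing by the one of least
  -- index makes all exponents of `t` nonnegative, so the sum becomes a polynomial in `t`.
  set i₀ := I.min' hIne
  have hi₀ : i₀ ∈ I := I.min'_mem hIne
  have hle : ∀ i ∈ I, i₀ ≤ i := fun i hi ↦ I.min'_le i hi
  have hgI : ∀ i ∈ I, g i ≠ 0 := fun i hi ↦ (Finset.mem_filter.1 hi).2.1
  have hoI : ∀ i ∈ I, (g i * f ^ i).order = m := fun i hi ↦ (Finset.mem_filter.1 hi).2.2
  have hne : ∀ i ∈ I, g i * f ^ i ≠ 0 := fun i hi ↦ mul_ne_zero (hgI i hi) (pow_ne_zero _ hf0)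
  have hlow : ∀ q < m, z.coeff q = 0 := by
    intro q hq
    rw [hzdef, HahnSeries.coeff_sum]
    refine Finset.sum_eq_zero fun i hi ↦ ?_
    by_cases hgi : g i = 0
    · simp [hgi]
    · exact HahnSeries.coeff_eq_zero_of_lt_order
        (hq.trans_le (hmin₁ i (Finset.mem_filter.2 ⟨hi, hgi⟩)))
  have hm : z.coeff m = ∑ i ∈ I, leadingCoeffHom κ (g i * f ^ i) := by
    rw [hzdef, HahnSeries.coeff_sum, hI, Finset.sum_filter]
    refine Finset.sum_congr rfl fun i hi ↦ ?_
    split_ifs with hcond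
    · rw [leadingCoeffHom_eq_coeff, hcond.2]
    · by_cases hgi : g i = 0
      · simp [hgi]
      · refine HahnSeries.coeff_eq_zero_of_lt_order (lt_of_le_of_ne
          (hmin₁ i (Finset.mem_filter.2 ⟨hi, hgi⟩)) fun h' ↦ hcond ⟨hgi, h'.symm⟩)
  set a₀ := leadingCoeffHom κ (g i₀ * f ^ i₀) with ha₀
  have ha₀0 : a₀ ≠ 0 := leadingCoeffHom_eq_zero.not.2 (hne _ hi₀)
  have hterm : ∀ i ∈ I, ∃ j : ℕ, i = i₀ + e * j ∧ ∃ a : F,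
      leadingCoeffHom κ (g i * f ^ i) / a₀ = a * t ^ j := by
    intro i hi
    have heq : g i * (g i₀)⁻¹ * f ^ ((i : ℤ) - i₀) = (g i * f ^ i) * (g i₀ * f ^ i₀)⁻¹ := by
      rw [zpow_sub₀ hf0, zpow_natCast, zpow_natCast, mul_inv, div_eq_mul_inv]; ring
    obtain ⟨j, hj, hmem⟩ := h (i - i₀) (g i * (g i₀)⁻¹)
      (mul_ne_zero (hgI i hi) (inv_ne_zero (hgI _ hi₀))) ((hg i).mul hc (hg i₀).inv) (by
        rw [heq, HahnSeries.order_mul (hne i hi) (inv_ne_zero (hne _ hi₀)), order_inv, hoI i hi,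
          hoI _ hi₀, add_neg_cancel])
    have hii := hle i hi
    have hj0 : 0 ≤ j := by
      by_contra hneg
      have : (e : ℤ) * j < 0 := mul_neg_of_pos_of_neg (by omega) (by omega)
      omega
    lift j to ℕ using hj0
    rw [heq] at hmem
    refine ⟨j, by zify; omega, ⟨_, hmem⟩, ?_⟩
    simp only [map_mul _ _ (g i₀ * f ^ i₀)⁻¹, map_inv₀, zpow_natCast, ← ha₀]
    rw [← div_eq_mul_inv, div_mul_cancel₀ _ (pow_ne_zero _ ht0)]
  choose! j hj a ha using hterm
  set p : Polynomial F := ∑ i ∈ I, Polynomial.monomial (j i) (a i) with hp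
  have hcoeff : z.coeff m / a₀ = Polynomial.aeval t p := by
    rw [hm, Finset.sum_div, hp, map_sum]
    refine Finset.sum_congr rfl fun i hi ↦ ?_
    rw [ha i hi, Polynomial.aeval_monomial]
    rfl
  have ha₁ : a i₀ ≠ 0 := by
    intro h0
    have := ha i₀ hi₀
    rw [h0, ← ha₀, div_self ha₀0] at this
    simp at this
  -- Distinct indices `i = i₀ + e * j` give distinct exponents `j`, so nothing cancels in `p`; as
  -- `t` is transcendental over `F`, the coefficient at `m` survives.
  have hp0 : p ≠ 0 := by
    intro hp0
    have : p.coeff (j i₀) = a i₀ := by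
      rw [hp, Polynomial.finsetSum_coeff, Finset.sum_eq_single i₀]
      · simp
      · intro i hi hne
        rw [Polynomial.coeff_monomial, if_neg]
        intro heq
        apply hne
        have h1 := hj i hi
        have h2 := hj i₀ hi₀
        rw [heq] at h1
        omega
      · exact fun h ↦ absurd hi₀ h
    rw [hp0, Polynomial.coeff_zero] at this
    exact ha₁ this.symm
  have hval : Polynomial.aeval t p ≠ 0 := fun h0 ↦
    hp0 ((transcendental_iff.1 (transcendental_of_notMem hF ht)) p h0)
  have hcm : z.coeff m ≠ 0 := by
    intro h0
    rw [h0, zero_div] at hcoeff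
    exact hval hcoeff.symm
  have hzo : z.order = m := by
    refine le_antisymm (HahnSeries.order_le_of_coeff_ne_zero hcm) (le_of_not_gt fun hlt ↦ hz ?_)
    exact HahnSeries.coeff_order_eq_zero.1 (hlow _ hlt)
  refine ⟨i₀, hgI _ hi₀, hzo.trans (hoI _ hi₀).symm, ?_⟩
  rw [leadingCoeffHom_eq_coeff, hzo, ← ha₀, hcoeff, hp, map_sum]
  have htE : t ∈ Subfield.closure ((F : Set κ) ∪ {t}) := Subfield.subset_closure (Or.inr rfl)
  refine Subfield.sum_mem _ fun i hi ↦ ?_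
  rw [Polynomial.aeval_monomial]
  exact Subfield.mul_mem _ (Subfield.subset_closure (Or.inl (a i).2))
    (pow_mem htE _)

end LeadingCoefficients

/-! ### Abhyankar's inequality and the ruled residue theorem -/

section RuledResidueField

open scoped LaurentSeries Polynomial

universe u

variable {κ : Type*} [Field κ]

theorem mem_range_ofPowerSeries {z : κ⸨X⸩} (hz : 0 ≤ z.order) :
    z ∈ (HahnSeries.ofPowerSeries ℤ κ).range := by
  refine ⟨PowerSeries.mk fun n ↦ z.coeff n, ?_⟩
  ext i
  rw [PowerSeries.coeff_coe]
  split_ifs with hi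
  · exact (HahnSeries.coeff_eq_zero_of_lt_order (hi.trans_le hz)).symm
  · rw [PowerSeries.coeff_mk, Int.natAbs_of_nonneg (not_lt.1 hi)]

theorem coeff_zero_mul {y z : κ⸨X⸩} (hy : y ∈ (HahnSeries.ofPowerSeries ℤ κ).range)
    (hz : z ∈ (HahnSeries.ofPowerSeries ℤ κ).range) :
    (y * z).coeff 0 = y.coeff 0 * z.coeff 0 := by
  obtain ⟨p, rfl⟩ := hy
  obtain ⟨q, rfl⟩ := hz
  rw [← map_mul, PowerSeries.coeff_coe, PowerSeries.coeff_coe, PowerSeries.coeff_coe]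
  simp

variable {k K : Type*} [Field k] [Field K] [Algebra k κ] [Algebra k K]

theorem coeff_zero_aeval {φ : K →+* κ⸨X⸩}
    (hφ : ∀ a : k, φ (algebraMap k K a) = HahnSeries.C (algebraMap k κ a)) {ι : Type*} {y : ι → K}
    (hy : ∀ i, 0 ≤ (φ (y i)).order) (p : MvPolynomial ι k) :
    φ (MvPolynomial.aeval y p) ∈ (HahnSeries.ofPowerSeries ℤ κ).range ∧
      (φ (MvPolynomial.aeval y p)).coeff 0 =
        MvPolynomial.aeval (fun i ↦ (φ (y i)).coeff 0) p := by
  induction p using MvPolynomial.induction_on with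
  | C a =>
    rw [MvPolynomial.aeval_C, MvPolynomial.aeval_C, hφ]
    exact ⟨⟨PowerSeries.C (algebraMap k κ a), HahnSeries.ofPowerSeries_C _⟩, by
      simp [HahnSeries.C_apply]⟩
  | add p q hp hq =>
    rw [map_add, map_add, map_add]
    exact ⟨add_mem hp.1 hq.1, by rw [HahnSeries.coeff_add, hp.2, hq.2]⟩
  | mul_X p i hp =>
    have hi := mem_range_ofPowerSeries (hy i)
    rw [map_mul, map_mul, map_mul, MvPolynomial.aeval_X, MvPolynomial.aeval_X]
    exact ⟨mul_mem hp.1 hi, by rw [coeff_zero_mul hp.1 hi, hp.2]⟩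

/-- Elements with algebraically independent residues, together with an element of positive order,
are algebraically independent. -/
theorem algebraicIndependent_option_of_residues {φ : K →+* κ⸨X⸩}
    (hφ : ∀ a : k, φ (algebraMap k K a) = HahnSeries.C (algebraMap k κ a)) {ι : Type*} {y : ι → K}
    (hy : ∀ i, 0 ≤ (φ (y i)).order)
    (hind : AlgebraicIndependent k fun i ↦ (φ (y i)).coeff 0) {c : K} (hc : 0 < (φ c).order) :
    AlgebraicIndependent k (fun o : Option ι ↦ o.elim c y) := by
  have hne : ∀ p : MvPolynomial ι k, p ≠ 0 → (φ (MvPolynomial.aeval y p)).coeff 0 ≠ 0 := by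
    intro p hp h0
    rw [(coeff_zero_aeval hφ hy p).2] at h0
    exact hp (algebraicIndependent_iff.1 hind p h0)
  refine AlgebraicIndependent.option_iff.2 ⟨algebraicIndependent_iff.2 fun p hp ↦ ?_, fun halg ↦ ?_⟩
  · by_contra hp0
    exact hne p hp0 (by rw [hp, map_zero, HahnSeries.coeff_zero])
  have hc0 : c ≠ 0 := by rintro rfl; simp at hc
  -- Taking a relation for `c` with nonzero constant term and reducing to residues kills every other
  -- term, since `c` has positive order.
  obtain ⟨q, hq0, hq⟩ :=
    halg.exists_nonzero_coeff_and_aeval_eq_zero (mem_nonZeroDivisors_of_ne_zero hc0)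
  have hmem : ∀ r : Algebra.adjoin k (Set.range y), ∃ p : MvPolynomial ι k,
      MvPolynomial.aeval y p = (r : K) := by
    rintro ⟨r, hr⟩
    rw [Algebra.adjoin_range_eq_range_aeval] at hr
    exact hr
  have hcO := mem_range_ofPowerSeries hc.le
  have hqO : φ (Polynomial.aeval c q.divX) ∈ (HahnSeries.ofPowerSeries ℤ κ).range := by
    rw [Polynomial.aeval_eq_sum_range, map_sum]
    refine sum_mem fun i _ ↦ ?_
    obtain ⟨p, hp⟩ := hmem (q.divX.coeff i)
    rw [Algebra.smul_def, map_mul, map_pow]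
    refine mul_mem ?_ (pow_mem hcO _)
    have := (coeff_zero_aeval hφ hy p).1
    rw [hp] at this
    exact this
  obtain ⟨p, hp⟩ := hmem (q.coeff 0)
  have hp0 : p ≠ 0 := by
    rintro rfl
    rw [map_zero] at hp
    exact hq0 (Subtype.ext hp.symm)
  apply hne p hp0
  rw [← q.divX_mul_X_add, map_add, map_mul, Polynomial.aeval_X, Polynomial.aeval_C] at hq
  have h := congrArg (fun z ↦ (φ z).coeff 0) hq
  simp only [map_add, map_mul, HahnSeries.coeff_add, map_zero, HahnSeries.coeff_zero,
    coeff_zero_mul hqO hcO, HahnSeries.coeff_eq_zero_of_lt_order hc, mul_zero, zero_add] at h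
  rw [hp]
  exact h

/-- The set of residues of the elements of order zero of `K`. -/
def residues (φ : K →+* κ⸨X⸩) : Set κ :=
  {a | ∃ y : K, (φ y).order = 0 ∧ leadingCoeffHom κ (φ y) = a}

/-- Abhyankar's inequality: if `κ` were algebraic over the residues, a transcendence basis of
residues would lift to `K`, and adding `c` would give `trdeg κ + 1 ≤ trdeg K`, impossible for finite
degrees. -/
theorem not_isAlgebraic_adjoin_residues {k : Type*} {κ K : Type u} [Field k] [Field κ] [Field K]
    [Algebra k κ] [Algebra k K] {φ : K →+* κ⸨X⸩}
    (hφ : ∀ a : k, φ (algebraMap k K a) = HahnSeries.C (algebraMap k κ a))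
    {c : K} (hc : (φ c).order ≠ 0)
    (htr : Algebra.trdeg k K ≤ Algebra.trdeg k κ)
    (hfin : Algebra.trdeg k K < Cardinal.aleph0) :
    ¬ Algebra.IsAlgebraic (IntermediateField.adjoin k (residues φ)) κ := by
  intro halg
  wlog hpos : 0 < (φ c).order generalizing c
  · refine this (c := c⁻¹) ?_ ?_ <;> rw [map_inv₀, order_inv] <;> omega
  have : Algebra.IsAlgebraic (Algebra.adjoin k (residues φ)) κ :=
    IntermediateField.isAlgebraic_adjoin_iff_top.1 halg
  obtain ⟨s, hs, hbasis⟩ := exists_isTranscendenceBasis_subset (R := k) (residues φ)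
  replace hs : ∀ a : κ, a ∈ s → ∃ y : K, (φ y).order = 0 ∧ leadingCoeffHom κ (φ y) = a :=
    fun a ha ↦ hs ha
  choose! y hy0 hyc using hs
  have hopt := algebraicIndependent_option_of_residues hφ (y := fun i : s ↦ y i)
    (fun i ↦ (hy0 i i.2).ge) (by
      convert hbasis.1 using 1
      ext i
      rw [← hy0 i i.2, ← leadingCoeffHom_eq_coeff, hyc i i.2]) hpos
  have hcard := hopt.cardinalMk_le_trdeg
  have hs' : Cardinal.mk s = Algebra.trdeg k κ := hbasis.cardinalMk_eq_trdeg
  rw [Cardinal.mk_option, hs'] at hcard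
  have hle := (add_le_add_left htr 1).trans hcard
  obtain ⟨n, hn⟩ := Cardinal.lt_aleph0.1 hfin
  rw [hn] at hle
  norm_cast at hle
  omega

/-- The `f`-adic expansion by repeated Euclidean division: the digits have degree below that of `f`,
where `hmin` applies. -/
theorem exists_expansion {F : Subfield κ} {c : κ⸨X⸩} {φ : K →+* κ⸨X⸩} {x : κ⸨X⸩} {f : K[X]}
    (hdeg : 0 < f.natDegree)
    (hmin : ∀ g : K[X], g.natDegree < f.natDegree → ResiduallyIn F c (g.eval₂ φ x)) (p : K[X]) :
    ∃ (n : ℕ) (g : ℕ → κ⸨X⸩), (∀ i, ResiduallyIn F c (g i)) ∧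
      p.eval₂ φ x = ∑ i ∈ Finset.range n, g i * (f.eval₂ φ x) ^ i := by
  induction h : p.natDegree using Nat.strong_induction_on generalizing p with
  | _ d ih =>
  by_cases hd : p.natDegree < f.natDegree
  · exact ⟨1, fun _ ↦ p.eval₂ φ x, fun _ ↦ hmin p hd, by simp⟩
  have hq : (p / f).natDegree < d := by
    rcases eq_or_ne (p / f) 0 with h0 | h0
    · rw [h0, Polynomial.natDegree_zero]
      omega
    · have hp0 : p ≠ 0 := by rintro rfl; simp at h0
      exact h ▸ Polynomial.natDegree_lt_natDegree h0
        (Polynomial.degree_div_lt hp0 (Polynomial.natDegree_pos_iff_degree_pos.1 hdeg))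
  obtain ⟨n, g, hg, hsum⟩ := ih _ hq (p / f) rfl
  refine ⟨n + 1, fun i ↦ Nat.casesOn i ((p % f).eval₂ φ x) g, fun i ↦ ?_, ?_⟩
  · cases i with
    | zero => exact hmin _ (Polynomial.natDegree_mod_lt p hdeg.ne')
    | succ i => exact hg i
  · rw [Finset.sum_range_succ']
    conv_lhs => rw [← EuclideanDomain.div_add_mod p f, Polynomial.eval₂_add, Polynomial.eval₂_mul,
      hsum, Finset.mul_sum]
    simp only [pow_zero, mul_one]
    congr 1
    refine Finset.sum_congr rfl fun i _ ↦ ?_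
    ring

/-- If every constant of `κ⸨X⸩` is a rational expression in `x` over the field `K`, on which the
order is not trivial, and not all constants are algebraic over the residues of `K`, then `κ` is
generated by one element over the algebraic closure in it of the field of residues of `K`. -/
theorem exists_closure_insert_eq_top {F : Subfield κ} (hF : ∀ y : κ, IsAlgebraic F y → y ∈ F)
    (hF' : F ≠ ⊤) {φ : K →+* κ⸨X⸩} (hres : residues φ ⊆ F) {c : K} (hc : (φ c).order ≠ 0)
    {x : κ⸨X⸩} (hx : ∀ a : κ, ∃ p q : K[X], q.eval₂ φ x ≠ 0 ∧
      HahnSeries.C a * q.eval₂ φ x = p.eval₂ φ x) :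
    ∃ t, t ∉ F ∧ Subfield.closure ((F : Set κ) ∪ {t}) = ⊤ := by
  classical
  have hK : ∀ y : K, ResiduallyIn F (φ c) (φ y) := by
    intro y
    rcases eq_or_ne y 0 with rfl | hy
    · simpa using residuallyIn_zero hc
    have hc0 : c ≠ 0 := by rintro rfl; simp at hc
    have hy0 : φ y ≠ 0 := (map_ne_zero φ).2 hy
    refine hres ⟨y ^ (φ c).order / c ^ (φ y).order, ?_, ?_⟩
    · rw [map_div₀, map_zpow₀, map_zpow₀, div_eq_mul_inv, HahnSeries.order_mul
        (zpow_ne_zero _ hy0) (inv_ne_zero (zpow_ne_zero _ ((map_ne_zero φ).2 hc0))),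
        order_inv, order_zpow, order_zpow]
      ring
    · simp only [map_div₀, map_zpow₀]
  -- If all polynomials in `x` were residually in `F`, so would be their quotients, among them all
  -- constants, forcing `F = ⊤`. A counterexample of least degree plays the role of a key
  -- polynomial.
  have hex : ∃ n : ℕ, ∃ f : K[X], f.natDegree = n ∧ ¬ ResiduallyIn F (φ c) (f.eval₂ φ x) := by
    by_contra! hall
    replace hall : ∀ f : K[X], ResiduallyIn F (φ c) (f.eval₂ φ x) := fun f ↦ hall _ f rfl
    refine hF' (top_unique fun a _ ↦ ?_)
    obtain ⟨p, q, hq, hpq⟩ := hx a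
    have hT := (hall p).mul hc (hall q).inv
    rw [← hpq, mul_assoc, mul_inv_cancel₀ hq, mul_one] at hT
    have := hT.leadingCoeff_mem hF hc HahnSeries.order_C
    rwa [leadingCoeffHom_eq_coeff, HahnSeries.order_C, HahnSeries.C_apply,
      HahnSeries.coeff_single_same] at this
  obtain ⟨f, hfn, hf⟩ := Nat.find_spec hex
  have hmin : ∀ g : K[X], g.natDegree < f.natDegree → ResiduallyIn F (φ c) (g.eval₂ φ x) := by
    intro g hg
    by_contra hg'
    exact Nat.find_min hex (hfn ▸ hg) ⟨g, rfl, hg'⟩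
  have hdeg : 0 < f.natDegree := by
    rw [Nat.pos_iff_ne_zero]
    intro h0
    rw [Polynomial.eq_C_of_natDegree_eq_zero h0, Polynomial.eval₂_C] at hf
    exact hf (hK _)
  have hf0 : f.eval₂ φ x ≠ 0 := by
    intro h0
    rw [h0] at hf
    exact hf (residuallyIn_zero hc)
  obtain ⟨e, he, t, ht, hgen⟩ := exists_residue_generator hF hc hf
  refine ⟨t, ht, top_unique fun a _ ↦ ?_⟩
  rcases eq_or_ne a 0 with rfl | ha
  · exact zero_mem _
  obtain ⟨p, q, hq, hpq⟩ := hx a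
  have hCa : (HahnSeries.C a : κ⸨X⸩) ≠ 0 := by simpa using ha
  have hp : p.eval₂ φ x ≠ 0 := hpq ▸ mul_ne_zero hCa hq
  have hlead := congrArg (leadingCoeffHom κ) hpq
  have hord := congrArg HahnSeries.order hpq
  rw [HahnSeries.order_mul hCa hq, HahnSeries.order_C, zero_add] at hord
  have hla : leadingCoeffHom κ (HahnSeries.C a) = a := by
    rw [leadingCoeffHom_eq_coeff, HahnSeries.order_C, HahnSeries.C_apply,
      HahnSeries.coeff_single_same]
  rw [map_mul, hla] at hlead
  obtain ⟨n, g, hg, hgp⟩ := exists_expansion hdeg hmin p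
  obtain ⟨m, h, hh, hhq⟩ := exists_expansion hdeg hmin q
  rw [hgp] at hp
  rw [hhq] at hq
  obtain ⟨i, hi, hio, hil⟩ := exists_leadingTerm_of_sum hF hf0 hc he ht hgen n g hg hp
  obtain ⟨j, hj, hjo, hjl⟩ := exists_leadingTerm_of_sum hF hf0 hc he ht hgen m h hh hq
  rw [← hgp] at hio hil hp
  rw [← hhq] at hjo hjl hq
  set u := f.eval₂ φ x
  have hgi : g i * u ^ i ≠ 0 := mul_ne_zero hi (pow_ne_zero _ hf0)
  have hhj : h j * u ^ j ≠ 0 := mul_ne_zero hj (pow_ne_zero _ hf0)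
  have heq : g i * (h j)⁻¹ * u ^ ((i : ℤ) - j) = (g i * u ^ i) * (h j * u ^ j)⁻¹ := by
    rw [zpow_sub₀ hf0, zpow_natCast, zpow_natCast, mul_inv, div_eq_mul_inv]; ring
  -- A constant has order zero, so the dominant terms of numerator and denominator have equal order,
  -- and the residue of their ratio is in `F` times a power of `t`.
  obtain ⟨l, -, hl⟩ := hgen (i - j) (g i * (h j)⁻¹) (mul_ne_zero hi (inv_ne_zero hj))
    ((hg i).mul hc (hh j).inv) (by
      rw [heq, HahnSeries.order_mul hgi (inv_ne_zero hhj), order_inv, ← hio, ← hjo, hord,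
        add_neg_cancel])
  have htE : t ∈ Subfield.closure ((F : Set κ) ∪ {t}) := Subfield.subset_closure (Or.inr rfl)
  have hl' : leadingCoeffHom κ (g i * (h j)⁻¹ * u ^ ((i : ℤ) - j)) / t ^ l ∈
      Subfield.closure ((F : Set κ) ∪ {t}) := Subfield.subset_closure (Or.inl hl)
  have ht0 : t ≠ 0 := by rintro rfl; exact ht F.zero_mem
  have hmem := Subfield.mul_mem _ (Subfield.div_mem _ hil hjl)
    (Subfield.mul_mem _ hl' (zpow_mem htE l))
  rw [div_mul_cancel₀ _ (zpow_ne_zero _ ht0), heq, map_mul _ _ (h j * u ^ j)⁻¹, map_inv₀] at hmem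
  convert hmem using 1
  have h1 : leadingCoeffHom κ (g i * u ^ i) ≠ 0 := leadingCoeffHom_eq_zero.not.2 hgi
  have h2 : leadingCoeffHom κ (h j * u ^ j) ≠ 0 := leadingCoeffHom_eq_zero.not.2 hhj
  have h3 : leadingCoeffHom κ (q.eval₂ φ x) ≠ 0 := leadingCoeffHom_eq_zero.not.2 hq
  rw [← hlead]
  field_simp

/-- A form of the ruled residue theorem, for the order of Laurent series. -/
theorem exists_ruled_of_laurentSeries {k : Type*} {κ K : Type u} [Field k] [Field κ] [Field K]
    [Algebra k κ] [Algebra k K] {φ : K →+* κ⸨X⸩}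
    (hφ : ∀ a : k, φ (algebraMap k K a) = HahnSeries.C (algebraMap k κ a))
    {c : K} (hc : (φ c).order ≠ 0)
    (htr : Algebra.trdeg k K ≤ Algebra.trdeg k κ)
    (hfin : Algebra.trdeg k K < Cardinal.aleph0)
    {x : κ⸨X⸩} (hx : ∀ a : κ, ∃ p q : K[X], q.eval₂ φ x ≠ 0 ∧
      HahnSeries.C a * q.eval₂ φ x = p.eval₂ φ x) :
    ∃ (F : Subfield κ) (t : κ), (∀ a : k, algebraMap k κ a ∈ F) ∧ Transcendental F t ∧
      Subfield.closure ((F : Set κ) ∪ {t}) = ⊤ := by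
  set E := IntermediateField.adjoin k (residues φ)
  set F := (algebraicClosure E κ).toSubfield with hFdef
  have hF : ∀ y : κ, IsAlgebraic F y → y ∈ F := by
    intro y hy
    have hy' : y ∈ algebraicClosure (algebraicClosure E κ) κ := mem_algebraicClosure_iff.2 hy
    rw [algebraicClosure.algebraicClosure_eq_bot, IntermediateField.mem_bot] at hy'
    obtain ⟨z, rfl⟩ := hy'
    exact z.2
  have hEF : ∀ y ∈ E, y ∈ F := fun y hy ↦
    (algebraicClosure E κ).algebraMap_mem ⟨y, hy⟩
  have hF' : F ≠ ⊤ := by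
    intro htop
    refine not_isAlgebraic_adjoin_residues hφ hc htr hfin ⟨fun y ↦ ?_⟩
    have : y ∈ F := htop ▸ Subfield.mem_top y
    exact mem_algebraicClosure_iff.1 this
  obtain ⟨t, ht, hcl⟩ := exists_closure_insert_eq_top hF hF'
    (fun y hy ↦ hEF y (IntermediateField.subset_adjoin k _ hy)) hc hx
  exact ⟨F, t, fun a ↦ hEF _ (E.algebraMap_mem a), transcendental_of_notMem hF ht, hcl⟩

end RuledResidueField

/-! ### Local slices and kernels of locally nilpotent derivations -/

section LocallyNilpotent

open scoped Polynomial

variable {B : Type*} [CommRing B]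

theorem mem_ker {D : Derivation ℤ B B} {b : B} : b ∈ ker D ↔ D b = 0 := Iff.rfl

/-- A derivation that vanishes on a subring `A` is an `A`-derivation. -/
def derivationOver (A : Subring B) (D : Derivation ℤ B B) (h : A ≤ ker D) : Derivation A B B :=
  Derivation.mk'
    { toFun := D
      map_add' := map_add D
      map_smul' := fun a b ↦ by
        have ha : D a = 0 := h a.2
        change D (a * b) = a * D b
        rw [D.leibniz, ha, smul_zero, add_zero, smul_eq_mul] }
    D.leibniz

theorem derivation_aeval {A : Subring B} {D : Derivation ℤ B B} (h : A ≤ ker D) (p : A[X]) (s : B) :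
    D (Polynomial.aeval s p) = Polynomial.aeval s p.derivative * D s :=
  (derivationOver A D h).map_aeval p s

/-- If `n + 2` is the nilpotency index of some `b` with `D b ≠ 0`, then `D^[n] b` is a local slice.
-/
theorem exists_slice {D : Derivation ℤ B B} (hD : D ∈ LND B) (h0 : D ≠ 0) :
    ∃ s, D s ≠ 0 ∧ D (D s) = 0 := by
  classical
  obtain ⟨b, hb⟩ : ∃ b, D b ≠ 0 := by
    by_contra! h
    exact h0 (Derivation.ext h)
  have hmin : ∀ m < Nat.find (hD b), D^[m] b ≠ 0 := fun m hm ↦ Nat.find_min (hD b) hm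
  have hspec := Nat.find_spec (hD b)
  match hn : Nat.find (hD b) with
  | 0 => rw [hn] at hspec; exact absurd (by rw [show b = 0 from hspec, map_zero]) hb
  | 1 => rw [hn] at hspec; exact absurd hspec hb
  | n + 2 =>
    rw [hn] at hspec hmin
    refine ⟨D^[n] b, ?_, ?_⟩
    · rw [← Function.iterate_succ_apply' D]
      exact hmin _ (by omega)
    · rwa [← Function.iterate_succ_apply' D, ← Function.iterate_succ_apply' D]

/-- Integration up to an integer factor, so that no division in `A` is needed. -/
theorem exists_derivative_eq_nsmul {A : Type*} [CommRing A] (p : A[X]) :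
    ∃ n : ℕ, n ≠ 0 ∧ ∃ q : A[X], q.derivative = n • p := by
  induction p using Polynomial.induction_on' with
  | add p q hp hq =>
    obtain ⟨m, hm, p', hp'⟩ := hp
    obtain ⟨n, hn, q', hq'⟩ := hq
    refine ⟨m * n, mul_ne_zero hm hn, n • p' + m • q', ?_⟩
    rw [Polynomial.derivative_add, Polynomial.derivative_smul, Polynomial.derivative_smul, hp', hq',
      smul_smul, smul_smul, smul_add, mul_comm n m]
  | monomial n a =>
    refine ⟨n + 1, n.succ_ne_zero, Polynomial.monomial (n + 1) a, ?_⟩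
    rw [Polynomial.derivative_monomial, Nat.add_sub_cancel, Polynomial.smul_monomial, nsmul_eq_mul,
      mul_comm]

variable [IsDomain B]

theorem mem_fracSubring {A : Subring B} {z : FractionRing B} :
    z ∈ fracSubring A ↔ ∃ a ∈ A, ∃ b ∈ A, b ≠ 0 ∧
      algebraMap B (FractionRing B) a / algebraMap B (FractionRing B) b = z := by
  rw [fracSubring, Subfield.mem_closure_iff, ← Subring.coe_map, Subring.closure_eq]
  constructor
  · rintro ⟨_, ⟨a, ha, rfl⟩, _, ⟨b, hb, rfl⟩, rfl⟩
    rcases eq_or_ne b 0 with rfl | hb0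
    · exact ⟨0, A.zero_mem, 1, A.one_mem, one_ne_zero, by simp⟩
    · exact ⟨a, ha, b, hb, hb0, rfl⟩
  · rintro ⟨a, ha, b, hb, -, rfl⟩
    exact ⟨_, ⟨a, ha, rfl⟩, _, ⟨b, hb, rfl⟩, rfl⟩

theorem algebraMap_mem_fracSubring {A : Subring B} {a : B} (ha : a ∈ A) :
    algebraMap B (FractionRing B) a ∈ fracSubring A :=
  Subfield.subset_closure ⟨a, ha, rfl⟩

theorem algebraMap_mem_fracSubring_ker_iff {D : Derivation ℤ B B} {b : B} :
    algebraMap B (FractionRing B) b ∈ fracSubring (ker D) ↔ D b = 0 := by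
  refine ⟨fun h ↦ ?_, fun h ↦ algebraMap_mem_fracSubring h⟩
  obtain ⟨a, ha, c, hc, hc0, h⟩ := mem_fracSubring.1 h
  have hinj := IsFractionRing.injective B (FractionRing B)
  rw [div_eq_iff ((map_ne_zero_iff _ hinj).2 hc0), ← map_mul] at h
  have h' := congrArg D (hinj h)
  rw [mem_ker.1 ha, D.leibniz, mem_ker.1 hc, smul_zero, zero_add, smul_eq_mul] at h'
  exact (mul_eq_zero.1 h'.symm).resolve_left hc0

variable [CharZero B]

/-- Induction on the nilpotency index of `b`: a polynomial expression for `D b` is integrated in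
`s`, and the result differs from a multiple of `b` by an element of `ker D`. -/
theorem exists_mul_eq_aeval {D : Derivation ℤ B B} (hD : D ∈ LND B) {s : B} (hs : D s ≠ 0)
    (hs' : D (D s) = 0) (b : B) :
    ∃ α : ker D, α ≠ 0 ∧ ∃ p : (ker D)[X], α * b = Polynomial.aeval s p := by
  obtain ⟨n, hn⟩ := hD b
  induction n generalizing b with
  | zero => exact ⟨1, one_ne_zero, 0, by rw [show b = 0 from hn]; simp⟩
  | succ n ih =>
    obtain ⟨α, hα, p, hp⟩ := ih (D b) hn
    obtain ⟨m, hm, q, hq⟩ := exists_derivative_eq_nsmul p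
    let a : ker D := ⟨D s, hs'⟩
    have ha : a ≠ 0 := fun h ↦ hs (congrArg Subtype.val h)
    have hm' : (m : ker D) ≠ 0 := fun h ↦ hm (by
      have := congrArg Subtype.val h
      exact_mod_cast this)
    have hc : D ((m * α * a : ker D) * b - Polynomial.aeval s q) = 0 := by
      have h1 : D ((m * α * a : ker D) : B) = 0 := (m * α * a : ker D).2
      rw [map_sub, derivation_aeval le_rfl, hq, D.leibniz, h1, smul_zero, add_zero, smul_eq_mul,
        map_nsmul, ← hp]
      simp only [Subring.coe_mul, Subring.coe_natCast, nsmul_eq_mul, a]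
      ring
    refine ⟨m * α * a, mul_ne_zero (mul_ne_zero hm' hα) ha,
      q + Polynomial.C ⟨(m * α * a : ker D) * b - Polynomial.aeval s q, hc⟩, ?_⟩
    rw [map_add, Polynomial.aeval_C]
    exact (add_sub_cancel _ _).symm

/-- Applying `D` to a relation for `s` and cancelling `D s` yields its derivative, of lower degree;
in characteristic zero only constants have derivative zero. -/
theorem transcendental_slice {D : Derivation ℤ B B} {s : B} (hs : D s ≠ 0) :
    Transcendental (ker D) s := by
  rw [transcendental_iff]
  intro p hp
  induction hd : p.natDegree using Nat.strong_induction_on generalizing p with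
  | _ d ih =>
  have hder : p.derivative = 0 := by
    by_cases h0 : p.natDegree = 0
    · exact Polynomial.derivative_of_natDegree_zero h0
    refine ih _ (hd ▸ Polynomial.natDegree_derivative_lt h0) _ ?_ rfl
    have h := derivation_aeval le_rfl p s (D := D)
    rw [hp, map_zero] at h
    exact (mul_eq_zero.1 h.symm).resolve_right hs
  rw [Polynomial.eq_C_of_derivative_eq_zero hder, Polynomial.aeval_C] at hp
  rw [Polynomial.eq_C_of_derivative_eq_zero hder, show p.coeff 0 = 0 from Subtype.ext hp, map_zero]

/-- Kernels of nonzero locally nilpotent derivations are pairwise incomparable. -/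
theorem ker_eq_of_le {D D' : Derivation ℤ B B} (hD : D ∈ LND B) (hD0 : D ≠ 0) (hD0' : D' ≠ 0)
    (h : ker D ≤ ker D') : ker D = ker D' := by
  obtain ⟨s, hs, hs'⟩ := exists_slice hD hD0
  -- With `α * b = p(s)` and `β = p'(s)`, the chain rule holds for both derivations, since both
  -- vanish on the coefficients. So `D` and `D'` are proportional.
  have key : ∀ b, ∃ α β : B, α ≠ 0 ∧ α * D b = β * D s ∧ α * D' b = β * D' s := by
    intro b
    obtain ⟨α, hα, p, hp⟩ := exists_mul_eq_aeval hD hs hs' b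
    refine ⟨α, Polynomial.aeval s p.derivative, fun h0 ↦ hα (Subtype.ext h0), ?_, ?_⟩
    · have h1 : D α = 0 := α.2
      rw [← derivation_aeval le_rfl, ← hp, D.leibniz, h1, smul_zero, add_zero, smul_eq_mul]
    · have h1 : D' α = 0 := h α.2
      rw [← derivation_aeval h, ← hp, D'.leibniz, h1, smul_zero, add_zero, smul_eq_mul]
  have hs2 : D' s ≠ 0 := by
    intro h0
    refine hD0' (Derivation.ext fun b ↦ ?_)
    obtain ⟨α, β, hα, -, h2⟩ := key b
    rw [h0, mul_zero] at h2
    exact (mul_eq_zero.1 h2).resolve_left hα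
  refine le_antisymm h fun b hb ↦ ?_
  obtain ⟨α, β, hα, h1, h2⟩ := key b
  rw [mem_ker.1 hb, mul_zero] at h2
  rw [(mul_eq_zero.1 h2.symm).resolve_right hs2, zero_mul] at h1
  exact mem_ker.2 ((mul_eq_zero.1 h1).resolve_left hα)

theorem transcendental_fracSubring {D : Derivation ℤ B B} {s : B} (hs : D s ≠ 0) :
    Transcendental (fracSubring (ker D)) (algebraMap B (FractionRing B) s) := by
  let i : ker D →+* fracSubring (ker D) :=
    ((algebraMap B (FractionRing B)).comp (ker D).subtype).codRestrict _
      fun a ↦ algebraMap_mem_fracSubring a.2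
  let _ := i.toAlgebra
  have hi : ∀ a, ((algebraMap (ker D) (fracSubring (ker D)) a : fracSubring (ker D)) :
    FractionRing B) = algebraMap B _ a := fun a ↦ rfl
  have hinj := IsFractionRing.injective B (FractionRing B)
  have : FaithfulSMul (ker D) (fracSubring (ker D)) :=
    (faithfulSMul_iff_algebraMap_injective _ _).2 fun a b hab ↦
      Subtype.ext (hinj (congrArg Subtype.val hab))
  have : IsFractionRing (ker D) (fracSubring (ker D)) := by
    refine IsFractionRing.of_field _ _ fun z ↦ ?_
    obtain ⟨a, ha, b, hb, -, h⟩ := mem_fracSubring.1 z.2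
    exact ⟨⟨a, ha⟩, ⟨b, hb⟩, Subtype.ext h.symm⟩
  have : IsScalarTower (ker D) (fracSubring (ker D)) (FractionRing B) :=
    IsScalarTower.of_algebraMap_eq fun a ↦ rfl
  rw [Transcendental, ← IsFractionRing.isAlgebraic_iff (ker D) (fracSubring (ker D)),
    isAlgebraic_algebraMap_iff hinj]
  exact transcendental_slice hs

theorem exists_aeval_eq_algebraMap {D : Derivation ℤ B B} (hD : D ∈ LND B) {s : B} (hs : D s ≠ 0)
    (hs' : D (D s) = 0) (b : B) : ∃ p : (fracSubring (ker D))[X],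
      Polynomial.aeval (algebraMap B (FractionRing B) s) p = algebraMap B (FractionRing B) b := by
  obtain ⟨α, hα, p, hp⟩ := exists_mul_eq_aeval hD hs hs' b
  let i : ker D →+* fracSubring (ker D) :=
    ((algebraMap B (FractionRing B)).comp (ker D).subtype).codRestrict _
      fun a ↦ algebraMap_mem_fracSubring a.2
  have hα' : algebraMap B (FractionRing B) α ≠ 0 :=
    (map_ne_zero_iff _ (IsFractionRing.injective B _)).2 fun h ↦ hα (Subtype.ext h)
  refine ⟨Polynomial.C (i α)⁻¹ * p.map i, ?_⟩
  have h1 : Polynomial.aeval (algebraMap B (FractionRing B) s) (p.map i) =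
      algebraMap B (FractionRing B) (Polynomial.aeval s p) := by
    rw [Polynomial.aeval_def, Polynomial.eval₂_map, Polynomial.aeval_def, Polynomial.hom_eval₂]
    rfl
  rw [map_mul, Polynomial.aeval_C, h1, ← hp, map_mul]
  exact inv_mul_cancel_left₀ hα' _

/-- A locally nilpotent derivation vanishes on units. -/
theorem derivation_eq_zero_of_isUnit {D : Derivation ℤ B B} (hD : D ∈ LND B) {b : B}
    (hb : IsUnit b) : D b = 0 := by
  rcases eq_or_ne D 0 with rfl | hD0
  · rfl
  obtain ⟨s, hs, hs'⟩ := exists_slice hD hD0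
  obtain ⟨c, hc⟩ := hb.exists_right_inv
  obtain ⟨p, hp⟩ := exists_aeval_eq_algebraMap hD hs hs' b
  obtain ⟨q, hq⟩ := exists_aeval_eq_algebraMap hD hs hs' c
  -- `B` embeds in the polynomial ring in `s` over the fraction field of `ker D`, whose units are
  -- constants.
  have hpq : p * q = 1 := by
    refine sub_eq_zero.1 (transcendental_iff.1 (transcendental_fracSubring hs) _ ?_)
    rw [map_sub, map_mul, hp, hq, ← map_mul, hc, map_one, map_one, sub_self]
  obtain ⟨a, -, rfl⟩ := Polynomial.isUnit_iff.1 (IsUnit.of_mul_eq_one q hpq)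
  rw [Polynomial.aeval_C] at hp
  rw [← algebraMap_mem_fracSubring_ker_iff, ← hp]
  exact a.2

theorem exists_aeval_div_aeval {D : Derivation ℤ B B} (hD : D ∈ LND B) {s : B} (hs : D s ≠ 0)
    (hs' : D (D s) = 0) (z : FractionRing B) : ∃ p q : (fracSubring (ker D))[X],
      z = Polynomial.aeval (algebraMap B (FractionRing B) s) p /
        Polynomial.aeval (algebraMap B (FractionRing B) s) q := by
  obtain ⟨a, b, -, rfl⟩ := IsFractionRing.div_surjective (A := B) z
  obtain ⟨p, hp⟩ := exists_aeval_eq_algebraMap hD hs hs' a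
  obtain ⟨q, hq⟩ := exists_aeval_eq_algebraMap hD hs hs' b
  exact ⟨p, q, by rw [← hp, ← hq]⟩

theorem aeval_mem_closure {M : Type*} [Field M] {F : Subfield M} (s : M) (p : F[X]) :
    Polynomial.aeval s p ∈ Subfield.closure ((F : Set M) ∪ {s}) := by
  have hs : s ∈ Subfield.closure ((F : Set M) ∪ {s}) := Subfield.subset_closure (Or.inr rfl)
  rw [Polynomial.aeval_eq_sum_range]
  exact sum_mem fun i _ ↦ mul_mem (Subfield.subset_closure (Or.inl (p.coeff i).2)) (pow_mem hs i)

theorem closure_fracSubring_ker_union {D : Derivation ℤ B B} (hD : D ∈ LND B) {s : B}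
    (hs : D s ≠ 0) (hs' : D (D s) = 0) :
    Subfield.closure ((fracSubring (ker D) : Set (FractionRing B)) ∪
      {algebraMap B (FractionRing B) s}) = ⊤ := by
  refine top_unique fun z _ ↦ ?_
  obtain ⟨p, q, rfl⟩ := exists_aeval_div_aeval hD hs hs' z
  exact div_mem (aeval_mem_closure (F := fracSubring (ker D)) _ p)
    (aeval_mem_closure (F := fracSubring (ker D)) _ q)

end LocallyNilpotent

/-! ### Expansion at infinity and two presentations of one field -/

section TwoKernels

open scoped LaurentSeries Polynomial

/-- Evaluation of polynomials over `κ` at `X⁻¹`, in the field of Laurent series. -/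
noncomputable def evalInvX (κ : Type*) [Field κ] : κ[X] →+* κ⸨X⸩ :=
  Polynomial.eval₂RingHom HahnSeries.C (HahnSeries.single (-1) 1)

theorem coeff_evalInvX {κ : Type*} [Field κ] (p : κ[X]) (n : ℕ) :
    (evalInvX κ p).coeff (-n) = p.coeff n := by
  rw [evalInvX, Polynomial.coe_eval₂RingHom]
  induction p using Polynomial.induction_on' with
  | add p q hp hq =>
    rw [Polynomial.eval₂_add, HahnSeries.coeff_add, hp, hq, Polynomial.coeff_add]
  | monomial m a =>
    rw [Polynomial.eval₂_monomial, HahnSeries.single_pow, one_pow, HahnSeries.C_mul_eq_smul,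
      HahnSeries.coeff_smul, HahnSeries.coeff_single, Polynomial.coeff_monomial]
    by_cases h : m = n
    · simp [h]
    · have : ¬ (-(n : ℤ) = m • (-1 : ℤ)) := by simp; omega
      rw [if_neg this, if_neg h, smul_zero]

theorem evalInvX_injective (κ : Type*) [Field κ] : Function.Injective (evalInvX κ) := by
  refine (injective_iff_map_eq_zero _).2 fun p hp ↦ Polynomial.ext fun n ↦ ?_
  rw [← coeff_evalInvX, hp, HahnSeries.coeff_zero, Polynomial.coeff_zero]

theorem order_evalInvX_ne_zero {κ : Type*} [Field κ] {p : κ[X]} (hp : p.natDegree ≠ 0) :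
    (evalInvX κ p).order ≠ 0 := by
  have h0 : p ≠ 0 := by rintro rfl; simp at hp
  have := HahnSeries.order_le_of_coeff_ne_zero (x := evalInvX κ p) (g := -p.natDegree) (by
    rw [coeff_evalInvX]
    exact Polynomial.leadingCoeff_ne_zero.2 h0)
  omega

/-- If `M = L(s)` with `s` transcendental over `L`, expansion in powers of `s⁻¹` maps `M` to the
field of Laurent series over `L`. -/
theorem exists_expansion_at_infinity {L M : Type*} [Field L] [Field M] [Algebra L M] {s : M}
    (hs : Transcendental L s)
    (hgen : ∀ z : M, ∃ p q : L[X], z = Polynomial.aeval s p / Polynomial.aeval s q) :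
    ∃ ψ : M →+* L⸨X⸩, ∀ p : L[X], ψ (Polynomial.aeval s p) = evalInvX L p := by
  let _ : Algebra L[X] M := (Polynomial.aeval s).toRingHom.toAlgebra
  have : FaithfulSMul L[X] M :=
    (faithfulSMul_iff_algebraMap_injective _ _).2 (transcendental_iff_injective.1 hs)
  have : IsFractionRing L[X] M := IsFractionRing.of_field _ _ hgen
  exact ⟨IsFractionRing.lift (evalInvX_injective L), fun p ↦ IsFractionRing.lift_algebraMap _ p⟩

theorem trdeg_eq_one_of_aeval_div_aeval {L M : Type*} [Field L] [Field M] [Algebra L M] {s : M}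
    (hs : Transcendental L s)
    (hgen : ∀ z : M, ∃ p q : L[X], z = Polynomial.aeval s p / Polynomial.aeval s q) :
    Algebra.trdeg L M = 1 := by
  let _ : Algebra L[X] M := (Polynomial.aeval s).toRingHom.toAlgebra
  have : FaithfulSMul L[X] M :=
    (faithfulSMul_iff_algebraMap_injective _ _).2 (transcendental_iff_injective.1 hs)
  have : IsFractionRing L[X] M := IsFractionRing.of_field _ _ hgen
  have : IsScalarTower L L[X] M :=
    IsScalarTower.of_algebraMap_eq fun a ↦ (Polynomial.aeval_C s a).symm
  have : Algebra.IsAlgebraic L[X] M := IsLocalization.isAlgebraic M (nonZeroDivisors L[X])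
  have h := lift_trdeg_add_eq L L[X] M
  rw [Polynomial.trdeg_of_isDomain, trdeg_eq_zero, Cardinal.lift_one, Cardinal.lift_zero,
    add_zero] at h
  exact Cardinal.lift_injective (by rw [← h, Cardinal.lift_one])

/-- If `M = L(s) = L'(s')`, of finite transcendence degree over `k`, and `L'` contains a
nonconstant polynomial in `s` over `L`, then `L` is ruled over `k`. -/
theorem exists_ruled_of_two_generators {k M : Type*} [Field k] [Field M] [Algebra k M]
    (L L' : IntermediateField k M) {s s' : M} (hs : Transcendental L s)
    (hs' : Transcendental L' s')
    (hgen : ∀ z : M, ∃ p q : L[X], z = Polynomial.aeval s p / Polynomial.aeval s q)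
    (hgen' : ∀ z : M, ∃ p q : L'[X], z = Polynomial.aeval s' p / Polynomial.aeval s' q)
    {p : L[X]} (hp : p.natDegree ≠ 0) (hpL' : Polynomial.aeval s p ∈ L')
    (htr : Algebra.trdeg k M < Cardinal.aleph0) :
    ∃ (F : Subfield L) (t : L), (∀ a : k, algebraMap k L a ∈ F) ∧ Transcendental F t ∧
      Subfield.closure ((F : Set L) ∪ {t}) = ⊤ := by
  obtain ⟨ψ, hψ⟩ := exists_expansion_at_infinity hs hgen
  have hψC : ∀ a : L, ψ a = HahnSeries.C a := by
    intro a
    have h := hψ (Polynomial.C a)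
    rw [Polynomial.aeval_C] at h
    exact h.trans (Polynomial.eval₂_C _ _)
  have h1 : Algebra.trdeg k L + 1 = Algebra.trdeg k M := by
    rw [← trdeg_eq_one_of_aeval_div_aeval hs hgen]; exact trdeg_add_eq k L
  have h2 : Algebra.trdeg k L' + 1 = Algebra.trdeg k M := by
    rw [← trdeg_eq_one_of_aeval_div_aeval hs' hgen']; exact trdeg_add_eq k L'
  have hfin : Algebra.trdeg k L' < Cardinal.aleph0 := (h2 ▸ self_le_add_right _ _).trans_lt htr
  have hev : ∀ q : L'[X], q.eval₂ (ψ.comp (algebraMap L' M)) (ψ s') =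
      ψ (Polynomial.aeval s' q) := fun q ↦ (Polynomial.hom_eval₂ q _ ψ s').symm
  refine exists_ruled_of_laurentSeries (φ := ψ.comp (algebraMap L' M))
    (c := ⟨_, hpL'⟩) (x := ψ s') (fun a ↦ ?_) ?_ ?_ hfin fun a ↦ ?_
  · exact hψC (algebraMap k L a)
  · change (ψ (Polynomial.aeval s p)).order ≠ 0
    rw [hψ]
    exact order_evalInvX_ne_zero hp
  · exact (Cardinal.add_one_inj.1 (h2.trans h1.symm)).le
  · obtain ⟨u, v, huv⟩ := hgen' a
    -- The presentation as a quotient allows a zero denominator; then `a = 0` by the convention for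
    -- division, and `0 / 1` serves.
    rcases eq_or_ne (Polynomial.aeval s' v) 0 with hv | hv
    · refine ⟨0, 1, by simp, ?_⟩
      rw [hv, div_zero] at huv
      rw [show a = 0 from Subtype.ext huv]
      simp
    · refine ⟨u, v, ?_, ?_⟩
      · rw [hev]
        exact (map_ne_zero ψ).2 hv
      · rw [hev, hev, ← hψC, ← map_mul, huv, div_mul_cancel₀ _ hv]

end TwoKernels

/-! ### Application to rings that are not semi-rigid -/

section MainTheorem

open scoped Polynomial

/-- Otherwise `A` is the only possible member of codimension one: a family containing a nonzero
derivation has intersection `A`, any other has intersection `B`, of codimension zero. -/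
theorem exists_ker_ne {B : Type*} [CommRing B] [IsDomain B] (hB : ¬ IsSemiRigid B)
    (A : Subring B) : ∃ D ∈ LND B, D ≠ 0 ∧ ker D ≠ A := by
  by_contra! h
  refine hB ((Set.encard_le_encard (t := {A}) ?_).trans_eq (Set.encard_singleton A))
  rintro A' ⟨⟨Δ, hΔ, rfl⟩, htr⟩
  have hex : ∃ D ∈ Δ, D ≠ 0 := by
    by_contra! h0
    have htop : kerInter Δ = ⊤ := by
      refine top_unique (le_iInf₂ fun D hD ↦ ?_)
      rw [h0 D hD]
      exact fun b _ ↦ rfl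
    have : Algebra.IsAlgebraic (kerInter Δ) B := ⟨fun b ↦
      isAlgebraic_algebraMap (⟨b, htop ▸ Subring.mem_top b⟩ : kerInter Δ)⟩
    rw [trdeg_eq_zero] at htr
    simp at htr
  obtain ⟨D, hD, hD0⟩ := hex
  refine le_antisymm ((iInf₂_le D hD).trans (h D (hΔ hD) hD0).le) (le_iInf₂ fun D' hD' ↦ ?_)
  rcases eq_or_ne D' 0 with rfl | h0
  · exact fun b _ ↦ rfl
  · exact (h D' (hΔ hD') h0).ge

variable {k B : Type*} [Field k] [CharZero k] [CommRing B] [IsDomain B] [Algebra k B]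

/-- Derivations are only `ℤ`-linear here; they vanish on `k` because its nonzero elements are units.
-/
theorem baseField_le_fracSubring_ker {D : Derivation ℤ B B} (hD : D ∈ LND B) :
    baseField k B ≤ fracSubring (ker D) := by
  have : CharZero B := charZero_of_injective_algebraMap (algebraMap k B).injective
  rintro _ ⟨a, rfl⟩
  refine algebraMap_mem_fracSubring ?_
  rcases eq_or_ne a 0 with rfl | ha
  · simp
  · exact derivation_eq_zero_of_isUnit hD ((IsUnit.mk0 a ha).map (algebraMap k B))

variable (k) in
/-- The field of fractions of the kernel of a locally nilpotent derivation of `B`, as an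
intermediate field of `Frac B` over `k`. -/
noncomputable def fracKer {D : Derivation ℤ B B} (hD : D ∈ LND B) :
    IntermediateField k (FractionRing B) :=
  (fracSubring (ker D)).toIntermediateField fun a ↦ baseField_le_fracSubring_ker hD ⟨a, by
    rw [RingHom.comp_apply, ← IsScalarTower.algebraMap_apply]⟩

theorem exists_ruled_fracKer (htr : Algebra.trdeg k B < Cardinal.aleph0) (hB : ¬ IsSemiRigid B)
    {D : Derivation ℤ B B} (hD : D ∈ LND B) (hD0 : D ≠ 0) :
    ∃ (F : Subfield (fracKer k hD)) (t : fracKer k hD),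
      (∀ a : k, algebraMap k (fracKer k hD) a ∈ F) ∧ Transcendental F t ∧
      Subfield.closure ((F : Set (fracKer k hD)) ∪ {t}) = ⊤ := by
  have : CharZero B := charZero_of_injective_algebraMap (algebraMap k B).injective
  obtain ⟨D', hD', hD0', hne⟩ := exists_ker_ne hB (ker D)
  obtain ⟨c, hc', hc⟩ := SetLike.not_le_iff_exists.1 fun h ↦ hne (ker_eq_of_le hD' hD0' hD0 h)
  obtain ⟨s, hs, hss⟩ := exists_slice hD hD0
  obtain ⟨s', hs', hss'⟩ := exists_slice hD' hD0'
  obtain ⟨p, hp⟩ := exists_aeval_eq_algebraMap hD hs hss c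
  -- A constant `p` would put `c` in `Frac (ker D) ∩ B = ker D`.
  have hpdeg : p.natDegree ≠ 0 := by
    intro h0
    rw [Polynomial.eq_C_of_natDegree_eq_zero h0, Polynomial.aeval_C] at hp
    refine hc (algebraMap_mem_fracSubring_ker_iff.1 ?_)
    rw [← hp]
    exact (p.coeff 0).2
  have : FaithfulSMul k B := (faithfulSMul_iff_algebraMap_injective _ _).2
    (algebraMap k B).injective
  have : Algebra.IsAlgebraic B (FractionRing B) :=
    IsLocalization.isAlgebraic (FractionRing B) (nonZeroDivisors B)
  have hM := trdeg_add_eq k B (A := FractionRing B)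
  rw [trdeg_eq_zero (R := B), add_zero] at hM
  refine exists_ruled_of_two_generators (fracKer k hD) (fracKer k hD')
    (transcendental_fracSubring hs) (transcendental_fracSubring hs')
    (exists_aeval_div_aeval hD hs hss) (exists_aeval_div_aeval hD' hs' hss') (p := p) hpdeg ?_
    (hM ▸ htr)
  exact (congrArg (· ∈ fracSubring (ker D')) hp).mpr (algebraMap_mem_fracSubring hc')

theorem algebraicIndependent_map {L M ι : Type*} [Field L] [Field M] [Algebra L M]
    {F : Subfield L} {x : ι → M} (hx : AlgebraicIndependent F x) :
    AlgebraicIndependent (F.map (algebraMap L M)) x := by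
  let e : F →+* F.map (algebraMap L M) :=
    ((algebraMap L M).comp F.subtype).codRestrict _ fun a ↦ ⟨a, a.2, rfl⟩
  have he : Function.Surjective e := by
    rintro ⟨_, a, ha, rfl⟩
    exact ⟨⟨a, ha⟩, rfl⟩
  exact hx.ringHom_of_comp_eq e (RingHom.id M) he Function.injective_id rfl

theorem closure_map_union_singleton {L M : Type*} [Field L] [Field M] [Algebra L M]
    {F : Subfield L} {t : L} (h : Subfield.closure ((F : Set L) ∪ {t}) = ⊤) :
    Subfield.closure ((F.map (algebraMap L M) : Set M) ∪ {algebraMap L M t}) =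
      (algebraMap L M).fieldRange := by
  rw [RingHom.fieldRange_eq_map, ← h, RingHom.map_field_closure, Set.image_union,
    Set.image_singleton, Subfield.coe_map]

theorem fieldRange_fracKer {D : Derivation ℤ B B} (hD : D ∈ LND B) :
    (algebraMap (fracKer k hD) (FractionRing B)).fieldRange = fracSubring (ker D) := by
  ext z
  exact ⟨fun ⟨a, ha⟩ ↦ ha ▸ a.2, fun hz ↦ ⟨⟨z, hz⟩, rfl⟩⟩

theorem baseField_le_map {D : Derivation ℤ B B} {hD : D ∈ LND B} {F : Subfield (fracKer k hD)}
    (hF : ∀ a : k, algebraMap k (fracKer k hD) a ∈ F) :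
    baseField k B ≤ F.map (algebraMap (fracKer k hD) (FractionRing B)) := by
  rintro _ ⟨a, rfl⟩
  refine ⟨_, hF a, ?_⟩
  rw [← IsScalarTower.algebraMap_apply, RingHom.comp_apply, ← IsScalarTower.algebraMap_apply]

theorem isRuled_fracSubring_ker (htr : Algebra.trdeg k B < Cardinal.aleph0)
    (hB : ¬ IsSemiRigid B) {D : Derivation ℤ B B} (hD : D ∈ LND B) :
    IsRuled (baseField k B) (fracSubring (ker D)) := by
  have : CharZero B := charZero_of_injective_algebraMap (algebraMap k B).injective
  rcases eq_or_ne D 0 with rfl | hD0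
  -- The choice `⊤` is immaterial; only a nonzero locally nilpotent derivation is wanted.
  · obtain ⟨D', hD', hD0', -⟩ := exists_ker_ne hB ⊤
    obtain ⟨s, hs, hs'⟩ := exists_slice hD' hD0'
    have htop : fracSubring (ker (0 : Derivation ℤ B B)) = ⊤ := by
      refine top_unique fun z _ ↦ ?_
      obtain ⟨a, b, -, rfl⟩ := IsFractionRing.div_surjective (A := B) z
      exact div_mem (algebraMap_mem_fracSubring rfl) (algebraMap_mem_fracSubring rfl)
    rw [htop]
    refine ⟨fracSubring (ker D'), baseField_le_fracSubring_ker hD', le_top,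
      fun _ ↦ algebraMap B _ s, ?_, ?_⟩
    · exact algebraicIndependent_unique_type_iff.2 (transcendental_fracSubring hs)
    · rw [Set.range_const]
      exact closure_fracSubring_ker_union hD' hs hs'
  · obtain ⟨F, t, hF, ht, hcl⟩ := exists_ruled_fracKer htr hB hD hD0
    have hcl' := closure_map_union_singleton (M := FractionRing B) hcl
    rw [fieldRange_fracKer] at hcl'
    refine ⟨F.map (algebraMap (fracKer k hD) (FractionRing B)), baseField_le_map hF, ?_,
      fun _ ↦ algebraMap _ _ t, algebraicIndependent_map ?_, ?_⟩
    · rintro _ ⟨a, -, rfl⟩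
      exact a.2
    · exact algebraicIndependent_unique_type_iff.2
        (Transcendental.ringHom_of_comp_eq (RingHom.id F)
          (algebraMap (fracKer k hD) (FractionRing B)) ht Function.surjective_id
          (algebraMap (fracKer k hD) (FractionRing B)).injective rfl)
    · rw [Set.range_const]
      exact hcl'

theorem exists_isRationalFunctionField_two (htr : Algebra.trdeg k B < Cardinal.aleph0)
    (hB : ¬ IsSemiRigid B) : ∃ K : Subfield (FractionRing B), baseField k B ≤ K ∧
      IsRationalFunctionField K ⊤ 2 := by
  have : CharZero B := charZero_of_injective_algebraMap (algebraMap k B).injective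
  obtain ⟨D, hD, hD0, -⟩ := exists_ker_ne hB ⊤
  obtain ⟨s, hs, hs'⟩ := exists_slice hD hD0
  obtain ⟨F, t, hF, ht, hcl⟩ := exists_ruled_fracKer htr hB hD hD0
  have hcl' := closure_map_union_singleton (M := FractionRing B) hcl
  rw [fieldRange_fracKer] at hcl'
  have hind : AlgebraicIndependent F (Sum.elim (fun _ : Fin 1 ↦ algebraMap B (FractionRing B) s)
      (algebraMap (fracKer k hD) (FractionRing B) ∘ fun _ : Fin 1 ↦ t)) :=
    AlgebraicIndependent.sumElim_comp (algebraicIndependent_unique_type_iff.2 ht)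
      (algebraicIndependent_unique_type_iff.2 (transcendental_fracSubring hs))
  refine ⟨F.map (algebraMap (fracKer k hD) (FractionRing B)), baseField_le_map hF, _,
    (algebraicIndependent_map hind).comp _ (finSumFinEquiv (m := 1) (n := 1)).symm.injective,
    top_unique ?_⟩
  rw [EquivLike.range_comp, Set.Sum.elim_range, Set.range_const, Function.comp_def,
    Set.range_const, ← closure_fracSubring_ker_union hD hs hs', Subfield.closure_le,
    Set.union_subset_iff]
  refine ⟨?_, Set.singleton_subset_iff.2 (Subfield.subset_closure (Or.inr (Or.inl rfl)))⟩
  rw [← hcl']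
  exact Subfield.closure_mono (Set.union_subset_union_right _ Set.subset_union_right)

end MainTheorem

end LNDRuled

theorem mainTheorem5 {k B : Type*} [Field k] [CharZero k] [CommRing B] [IsDomain B] [Algebra k B]
    (htr : Algebra.trdeg k B < Cardinal.aleph0) (hB : ¬ LNDRuled.IsSemiRigid B) :
    (∀ D ∈ LNDRuled.LND B,
      LNDRuled.IsRuled (LNDRuled.baseField k B) (LNDRuled.fracSubring (LNDRuled.ker D))) ∧
    ∃ K : Subfield (FractionRing B), LNDRuled.baseField k B ≤ K ∧
      LNDRuled.IsRationalFunctionField K ⊤ 2 := by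
  exact ⟨fun _ hD ↦ LNDRuled.isRuled_fracSubring_ker htr hB hD,
    LNDRuled.exists_isRationalFunctionField_two htr hB⟩
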